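/- A modulus of continuity is a function $\omega:[0,\infty)\to[0,\infty)$ which is continuous, increasing, satisfies $\omega(0)=0$, and for which $\omega(t)/t$ is decreasing on $(0,\infty)$ with $\lim_{t\to0^+}\omega(t)/t=\infty$. Let $\mathbb{D}=\{z\in\mathbb{C}:|z|<1\}$ and $\mathbb{T}=\partial\mathbb{D}$, and let $\Lambda^\omega_a$ be the space of functions $f$ which are analytic in $\mathbb{D}$, extend continuously to $\overline{\mathbb{D}}$, and satisfy $$\sup_{z,w\in\overline{\mathbb{D}},\,z\ne w}\frac{|f(z)-f(w)|}{\omega(|z-w|)}<\infty.$$ A singular inner function is a function of the form $$\theta(z)=\exp\Big(-\int_{\mathbb{T}}\frac{\zeta+z}{\zeta-z}\,d\nu(\zeta)\Big),\qquad z\in\mathbb{D},$$ where $\nu\neq0$ is a finite positive Borel measure on $\mathbb{T}$ which is singular with respect to Lebesgue measure on $\mathbb{T}$. Let $H^2$ be the Hardy space of $\mathbb{D}$ with its inner product $\langle f,g\rangle=\lim_{r\to1^-}\frac1{2\pi}\int_0^{2\pi}f(re^{it})\overline{g(re^{it})}\,dt$, and let $K_\theta=H^2\ominus\theta H^2$ be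 the orthogonal complement of $\theta H^2$ in $H^2$. Theorem. Let $\omega$ be a modulus of continuity. There exists a singular inner function $\theta$ such that $$\Lambda^\omega_a\cap K_\theta=\{0\}.$$ -/

import Mathlib

open Set Filter Topology MeasureTheory
open scoped NNReal ENNReal ComplexConjugate

/-- The open unit disk `{z ∈ ℂ : |z| < 1}`. -/
abbrev openDisk : Set ℂ := Metric.ball (0 : ℂ) 1

/-- The closed unit disk `{z ∈ ℂ : |z| ≤ 1}`. -/
abbrev closedDisk : Set ℂ := Metric.closedBall (0 : ℂ) 1

/-- The circle carries its Borel `σ`-algebra. -/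
noncomputable instance circleMeasurableSpace : MeasurableSpace Circle := borel Circle

instance circleBorelSpace : BorelSpace Circle := ⟨rfl⟩

/-- Normalized arclength (Lebesgue) measure on the unit circle. -/
noncomputable def circleArcMeasure : Measure Circle :=
  (ENNReal.ofReal (2 * Real.pi))⁻¹ • (volume.restrict (Ioc (-Real.pi) Real.pi)).map Circle.exp

/-- The function `z ↦ exp (-∫ (ζ + z) / (ζ - z) dν(ζ))`, for a measure `ν` on the unit circle. -/
noncomputable def singularFactor (ν : Measure Circle) (z : ℂ) : ℂ :=
  Complex.exp (-∫ ζ : Circle, ((ζ : ℂ) + z) / ((ζ : ℂ) - z) ∂ν)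

/-- `θ` is, on the unit disk, a (nonconstant) singular inner function: it is generated by a
nonzero finite positive Borel measure on the circle which is singular to arclength measure. -/
def IsSingularInner (θ : ℂ → ℂ) : Prop :=
  ∃ ν : Measure Circle, IsFiniteMeasure ν ∧ ν ≠ 0 ∧ ν ⟂ₘ circleArcMeasure ∧
    ∀ z ∈ openDisk, θ z = singularFactor ν z

/-- The Hardy space `H²` of the unit disk: holomorphic functions with bounded square means over
the circles `|z| = r`, `0 ≤ r < 1`. A function on the disk is represented by a function on `ℂ`
of which only the values on the disk matter. -/
def hardySpace : Set (ℂ → ℂ) :=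
  {f | DifferentiableOn ℂ f openDisk ∧
    ∃ C : ℝ, ∀ r ∈ Ico (0 : ℝ) 1, Real.circleAverage (fun z => ‖f z‖ ^ 2) 0 r ≤ C}

/-- `c` is the `H²` inner product of `f` and `g`, that is, the limit as `r → 1⁻` of the mean of
`f * conj g` over the circle `|z| = r`. For `f` and `g` in `H²` this limit exists, and it is
the integral over the unit circle of the boundary values of `f * conj g`. -/
def HasHardyInner (f g : ℂ → ℂ) (c : ℂ) : Prop :=
  Tendsto (fun r : ℝ => Real.circleAverage (fun z => f z * conj (g z)) 0 r) (𝓝[<] 1) (𝓝 c)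

/-- The model space `K_θ = H² ⊖ θ H²`. -/
def modelSpace (θ : ℂ → ℂ) : Set (ℂ → ℂ) :=
  {f | f ∈ hardySpace ∧ ∀ h ∈ hardySpace, HasHardyInner f (fun z => θ z * h z) 0}

/-- Moduli of continuity `ω : [0, ∞) → [0, ∞)`. -/
structure IsModulusOfContinuity (ω : ℝ≥0 → ℝ≥0) : Prop where
  continuous : Continuous ω
  monotone : Monotone ω
  map_zero : ω 0 = 0
  antitone_div : AntitoneOn (fun t => ω t / t) (Ioi 0)
  tendsto_div : Tendsto (fun t => ω t / t) (𝓝[>] 0) atTop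

/-- The space `Λ^ω_a`: functions holomorphic in the unit disk, with a continuous extension `F` to
the closed disk such that `|F z - F w| / ω (|z - w|)` is bounded over `z ≠ w`. -/
def analyticModulusSpace (ω : ℝ≥0 → ℝ≥0) : Set (ℂ → ℂ) :=
  {f | DifferentiableOn ℂ f openDisk ∧
    ∃ F : ℂ → ℂ, ContinuousOn F closedDisk ∧ EqOn F f openDisk ∧
      ∃ C : ℝ, ∀ z ∈ closedDisk, ∀ w ∈ closedDisk, z ≠ w →
        ‖F z - F w‖ ≤ C * (ω (nndist z w) : ℝ)}

/-! Let `σ` be normalized arclength and `x` uniform in `[0, 1)`. Clearing the binary digits of `x`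
at sparse positions `p 0 < p 1 < …` and wrapping onto the circle gives a law `ν`, singular because
it lives on numbers with infinitely many prescribed zero digits. Clearing only the first `n`
positions gives a law `ν_n ≤ 2 ^ n • σ`, whatever the positions are. Let `θ`, `θ_n` be the factors
of `ν`, `ν_n`. Then `|1 / θ_n| ≤ exp (2 ^ n)` in the disk, while `θ / θ_n - 1` is as small as
desired on `|z| ≤ 1 - δ_n` once `p n` is large, since `ν` arises from `ν_n` by moving mass a
distance `O(2 ^ (-p n))`.

For `f` in the model space and `k_w` the Szegő kernel, `θ k_w / θ_n` is orthogonal to `f`, so `-f(w)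
= ⟨f, (θ / θ_n - 1) k_w⟩`. Write `f = (f - f_ρ) + f_ρ` with `f_ρ(z) = f(ρ z)`, `ρ = 1 - δ_n`. The
first term costs `ω(δ_n)` times the global bound `exp (2 ^ n) + 1`. In the second the dilation
passes to the other factor, so only the values on `|z| ≤ ρ` count. Choosing `δ_n` from `ω` first,
and then `p n`, makes both terms tend to `0`.

The carrying lemmas are `map_clearDigits_le`, `norm_inv_singularFactor_le`,
`norm_singularFactor_mul_inv_sub_one_le`, `circleAverage_dilation_mul_conj` and
`norm_le_of_mem_modelSpace`. -/

/-! ### Clearing one binary digit -/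

/-- Replace the `p`-th binary digit of `x` by `0`. -/
noncomputable def clearDigit (p : ℕ) (x : ℝ) : ℝ :=
  x - ((⌊2 ^ p * x⌋ % 2 : ℤ) : ℝ) / 2 ^ p

theorem measurable_clearDigit (p : ℕ) : Measurable (clearDigit p) := by
  have h : Measurable fun x : ℝ => ⌊2 ^ p * x⌋ :=
    Int.measurable_floor.comp (measurable_id.const_mul _)
  have h2 : Measurable fun m : ℤ => ((m % 2 : ℤ) : ℝ) := measurable_from_top
  exact measurable_id.sub ((h2.comp h).div_const _)

theorem clearDigit_le (p : ℕ) (x : ℝ) : clearDigit p x ≤ x := by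
  have : (0 : ℝ) ≤ ((⌊2 ^ p * x⌋ % 2 : ℤ) : ℝ) := by
    exact_mod_cast Int.emod_nonneg _ (by norm_num)
  have : 0 ≤ ((⌊2 ^ p * x⌋ % 2 : ℤ) : ℝ) / 2 ^ p := by positivity
  unfold clearDigit
  linarith

theorem floor_two_pow_mul_clearDigit_self (p : ℕ) (x : ℝ) :
    ⌊2 ^ p * clearDigit p x⌋ = ⌊2 ^ p * x⌋ - ⌊2 ^ p * x⌋ % 2 := by
  have : 2 ^ p * clearDigit p x = 2 ^ p * x - ((⌊2 ^ p * x⌋ % 2 : ℤ) : ℝ) := by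
    unfold clearDigit
    field_simp
  rw [this, Int.floor_sub_intCast]

theorem floor_two_pow_mul_eq_ediv {q p : ℕ} (h : q ≤ p) (x : ℝ) :
    ⌊2 ^ q * x⌋ = ⌊2 ^ p * x⌋ / 2 ^ (p - q) := by
  have h1 : 2 ^ q * x = 2 ^ p * x / ((2 ^ (p - q) : ℕ) : ℝ) := by
    obtain ⟨k, rfl⟩ := Nat.exists_eq_add_of_le h
    simp only [Nat.add_sub_cancel_left]
    push_cast
    rw [pow_add]
    field_simp
  rw [h1, Int.floor_div_natCast]
  push_cast
  rfl

/-- Clearing rounds `⌊2 ^ p * x⌋` down to an even integer, which leaves its quotient by `2 ^ (p -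
q)` unchanged because that divisor is even. -/
theorem floor_two_pow_mul_clearDigit {q p : ℕ} (h : q < p) (x : ℝ) :
    ⌊2 ^ q * clearDigit p x⌋ = ⌊2 ^ q * x⌋ := by
  rw [floor_two_pow_mul_eq_ediv h.le, floor_two_pow_mul_eq_ediv h.le,
    floor_two_pow_mul_clearDigit_self]
  obtain ⟨k, rfl⟩ := Nat.exists_eq_add_of_lt h
  have : q + k + 1 - q = k + 1 := by omega
  have h2 : (2 : ℤ) ^ (k + 1) = 2 * 2 ^ k := pow_succ' _ _
  rw [this, h2]
  rw [← Int.ediv_ediv_of_nonneg (by norm_num), ← Int.ediv_ediv_of_nonneg (by norm_num)]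
  congr 1
  omega

theorem clearDigit_eq_or (p : ℕ) (x : ℝ) :
    clearDigit p x = x ∨ clearDigit p x = x - (2 ^ p)⁻¹ := by
  unfold clearDigit
  rcases Int.emod_two_eq_zero_or_one ⌊2 ^ p * x⌋ with h | h <;> simp [h]

theorem abs_sub_le_of_floor_two_pow_eq {q : ℕ} {x y : ℝ} (h : ⌊2 ^ q * x⌋ = ⌊2 ^ q * y⌋) :
    |x - y| ≤ (2 ^ q)⁻¹ := by
  have h1 := Int.abs_sub_lt_one_of_floor_eq_floor h
  rw [← mul_sub, abs_mul, abs_of_pos (by positivity)] at h1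
  rw [← one_div, le_div_iff₀' (by positivity)]
  exact h1.le

/-- The unit interval `[0, 1)`, carved out by the integer part. -/
abbrev unitIco : Set ℝ := Ico (0 : ℝ) 1

/-- The factor `2 ^ 0` makes membership in `[0, 1)` the case `q = 0` of the floor invariance lemmas.
-/
theorem mem_unitIco_iff {x : ℝ} : x ∈ unitIco ↔ ⌊2 ^ 0 * x⌋ = 0 := by
  simp [Int.floor_eq_zero_iff]

/-- The map is piecewise the identity or the translation by `-2 ^ (-p)`, so the preimage of a set is
covered by the set and one translate: density at most doubles. -/
theorem map_clearDigit_le {p : ℕ} (hp : 0 < p) :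
    (volume.restrict unitIco).map (clearDigit p) ≤ (2 : ℝ≥0∞) • volume.restrict unitIco := by
  refine Measure.le_iff.2 fun A hA => ?_
  rw [Measure.map_apply (measurable_clearDigit p) hA, Measure.smul_apply,
    Measure.restrict_apply (measurable_clearDigit p hA), Measure.restrict_apply hA, smul_eq_mul]
  have hsub : clearDigit p ⁻¹' A ∩ unitIco ⊆
      (A ∩ unitIco) ∪ (fun x => x + -(2 ^ p)⁻¹) ⁻¹' (A ∩ unitIco) := by
    rintro x ⟨hxA, hxI⟩
    have hI : clearDigit p x ∈ unitIco := by
      rw [mem_unitIco_iff, floor_two_pow_mul_clearDigit hp, ← mem_unitIco_iff]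
      exact hxI
    rcases clearDigit_eq_or p x with h | h
    · left
      exact ⟨by simpa [h] using hxA, hxI⟩
    · right
      rw [mem_preimage, ← sub_eq_add_neg, ← h]
      exact ⟨hxA, hI⟩
  refine (measure_mono hsub).trans ((measure_union_le _ _).trans ?_)
  rw [measure_preimage_add_right, two_mul]

/-! ### Clearing finitely many and all digits -/

/-- Clear the digits `p 0, …, p (n - 1)`. -/
noncomputable def clearDigits (p : ℕ → ℕ) : ℕ → ℝ → ℝ
  | 0 => id
  | n + 1 => clearDigit (p n) ∘ clearDigits p n

theorem measurable_clearDigits (p : ℕ → ℕ) : ∀ n, Measurable (clearDigits p n)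
  | 0 => measurable_id
  | n + 1 => (measurable_clearDigit _).comp (measurable_clearDigits p n)

theorem antitone_clearDigits (p : ℕ → ℕ) (x : ℝ) : Antitone fun n => clearDigits p n x :=
  antitone_nat_of_succ_le fun _ => clearDigit_le _ _

/-- The bound depends on the number of cleared digits and not on their positions, which allows `p n`
to be chosen after every quantity governed by `2 ^ n`. -/
theorem map_clearDigits_le {p : ℕ → ℕ} (hp : ∀ n, 0 < p n) (n : ℕ) :
    (volume.restrict unitIco).map (clearDigits p n) ≤ (2 ^ n : ℝ≥0∞) • volume.restrict unitIco := by
  induction n with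
  | zero => simp [clearDigits]
  | succ n ih =>
    rw [clearDigits, ← Measure.map_map (measurable_clearDigit _) (measurable_clearDigits p n)]
    refine (Measure.map_mono ih (measurable_clearDigit _)).trans ?_
    rw [Measure.map_smul, pow_succ, mul_smul]
    gcongr
    exact map_clearDigit_le (hp n)

theorem floor_two_pow_mul_clearDigits {p : ℕ → ℕ} (hp : StrictMono p) {q n m : ℕ} (hq : q < p n)
    (hnm : n ≤ m) (x : ℝ) : ⌊2 ^ q * clearDigits p m x⌋ = ⌊2 ^ q * clearDigits p n x⌋ := by
  induction m, hnm using Nat.le_induction with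
  | base => rfl
  | succ m hnm ih =>
    rw [← ih]
    exact floor_two_pow_mul_clearDigit (hq.trans_le (hp.monotone hnm)) _

/-- Clear all the digits `p n`. -/
noncomputable def clearAllDigits (p : ℕ → ℕ) (x : ℝ) : ℝ := ⨅ n, clearDigits p n x

theorem measurable_clearAllDigits (p : ℕ → ℕ) : Measurable (clearAllDigits p) :=
  Measurable.iInf (measurable_clearDigits p)

theorem floor_two_pow_mul_clearAllDigits {p : ℕ → ℕ} (hp : StrictMono p) {q n : ℕ} (hq : q < p n)
    (x : ℝ) : ⌊2 ^ q * clearAllDigits p x⌋ = ⌊2 ^ q * clearDigits p n x⌋ := by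
  set k := ⌊2 ^ q * clearDigits p n x⌋ with hk
  -- The dyadic point `k / 2 ^ q` stays below every stage. This makes the real infimum meaningful
  -- and gives the lower half of the floor condition.
  have hlow : ∀ m, (k : ℝ) / 2 ^ q ≤ clearDigits p m x := by
    intro m
    have h1 : (k : ℝ) / 2 ^ q ≤ clearDigits p (max m n) x := by
      rw [div_le_iff₀' (by positivity), hk,
        ← floor_two_pow_mul_clearDigits hp hq (le_max_right m n)]
      exact Int.floor_le _
    exact h1.trans (antitone_clearDigits p x (le_max_left m n))
  have hbdd : BddBelow (range fun m => clearDigits p m x) := by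
    refine ⟨(k : ℝ) / 2 ^ q, ?_⟩
    rintro _ ⟨m, rfl⟩
    exact hlow m
  rw [Int.floor_eq_iff]
  constructor
  · rw [← div_le_iff₀' (by positivity)]
    exact le_ciInf hlow
  · refine lt_of_le_of_lt ?_ (Int.lt_floor_add_one (2 ^ q * clearDigits p n x))
    have := ciInf_le hbdd n
    unfold clearAllDigits
    gcongr

/-- Only digits at positions `p n` and beyond can still change, so the floors agree at level `p n -
1`; this level accounts for the factor `2`. -/
theorem abs_clearAllDigits_sub_le {p : ℕ → ℕ} (hp : StrictMono p) (n : ℕ) (hn : 0 < p n) (x : ℝ) :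
    |clearAllDigits p x - clearDigits p n x| ≤ 2 * (2 ^ p n)⁻¹ := by
  have h := abs_sub_le_of_floor_two_pow_eq
    (floor_two_pow_mul_clearAllDigits hp (Nat.sub_lt hn one_pos) x)
  refine h.trans (le_of_eq ?_)
  obtain ⟨k, hk⟩ := Nat.exists_eq_add_of_lt hn
  rw [hk]
  simp [pow_succ]

theorem clearAllDigits_mem_unitIco {p : ℕ → ℕ} (hp : StrictMono p) (h0 : 0 < p 0) {x : ℝ}
    (hx : x ∈ unitIco) : clearAllDigits p x ∈ unitIco := by
  rw [mem_unitIco_iff, floor_two_pow_mul_clearAllDigits hp h0]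
  exact mem_unitIco_iff.1 hx

theorem floor_clearAllDigits_emod_two {p : ℕ → ℕ} (hp : StrictMono p) (n : ℕ) (x : ℝ) :
    ⌊2 ^ p n * clearAllDigits p x⌋ % 2 = 0 := by
  rw [floor_two_pow_mul_clearAllDigits hp (hp n.lt_succ_self), clearDigits, Function.comp_apply,
    floor_two_pow_mul_clearDigit_self]
  omega

/-! ### The null set carrying the singular measure -/

/-- The points of `[0, 1)` whose digits `p i`, `i < n`, vanish. -/
def digitZeroSet (p : ℕ → ℕ) (n : ℕ) : Set ℝ :=
  {x | x ∈ unitIco ∧ ∀ i < n, ⌊2 ^ p i * x⌋ % 2 = 0}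

theorem measurableSet_digitZeroSet (p : ℕ → ℕ) (n : ℕ) : MeasurableSet (digitZeroSet p n) := by
  have h : ∀ i, Measurable fun x : ℝ => ⌊2 ^ p i * x⌋ := fun i =>
    Int.measurable_floor.comp (measurable_id.const_mul _)
  have heq : digitZeroSet p n =
      unitIco ∩ ⋂ i, ⋂ _ : i < n, (fun x : ℝ => ⌊2 ^ p i * x⌋) ⁻¹' {m : ℤ | m % 2 = 0} := by
    ext x
    simp [digitZeroSet]
  rw [heq]
  exact measurableSet_Ico.inter (MeasurableSet.iInter fun i => MeasurableSet.iInter fun _ =>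
    h i MeasurableSet.of_discrete)

/-- Adding `2 ^ (-p)` turns a digit `0` into `1`, and clearing that digit undoes the addition. -/
theorem floor_two_pow_mul_add_inv {q p : ℕ} (h : q < p) {x : ℝ} (hx : ⌊2 ^ p * x⌋ % 2 = 0) :
    ⌊2 ^ q * (x + (2 ^ p)⁻¹)⌋ = ⌊2 ^ q * x⌋ := by
  rw [← floor_two_pow_mul_clearDigit h]
  have h2 : ⌊2 ^ p * (x + (2 ^ p)⁻¹)⌋ % 2 = 1 := by
    rw [mul_add, mul_inv_cancel₀ (by positivity), Int.floor_add_one]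
    omega
  unfold clearDigit
  rw [h2]
  simp

/-- The set and its translate by `2 ^ (-p n)` differ in the digit `p n`, hence are disjoint, and
both lie in the previous set. -/
theorem volume_digitZeroSet_succ_le {p : ℕ → ℕ} (hp : StrictMono p) (h0 : 0 < p 0) (n : ℕ) :
    2 * volume (digitZeroSet p (n + 1)) ≤ volume (digitZeroSet p n) := by
  have hdisj : Disjoint (digitZeroSet p (n + 1))
      ((fun x => x + -(2 ^ p n)⁻¹) ⁻¹' digitZeroSet p (n + 1)) := by
    rw [Set.disjoint_left]
    intro x hx hx'
    have h1 := hx.2 n n.lt_succ_self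
    have h2 := hx'.2 n n.lt_succ_self
    have : 2 ^ p n * (x + -(2 ^ p n)⁻¹) = 2 ^ p n * x - 1 := by
      rw [mul_add, mul_neg, mul_inv_cancel₀ (by positivity)]
      ring
    rw [this, Int.floor_sub_one] at h2
    omega
  have hsub : digitZeroSet p (n + 1) ∪
      (fun x => x + -(2 ^ p n)⁻¹) ⁻¹' digitZeroSet p (n + 1) ⊆ digitZeroSet p n := by
    rintro x (hx | hx)
    · exact ⟨hx.1, fun i hi => hx.2 i (hi.trans n.lt_succ_self)⟩
    · set y := x + -(2 ^ p n)⁻¹ with hy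
      have hxy : x = y + (2 ^ p n)⁻¹ := by rw [hy]; ring
      have hyn := hx.2 n n.lt_succ_self
      rw [hxy]
      refine ⟨?_, fun i hi => ?_⟩
      · rw [mem_unitIco_iff, floor_two_pow_mul_add_inv (h0.trans_le (hp.monotone n.zero_le)) hyn,
          ← mem_unitIco_iff]
        exact hx.1
      · rw [floor_two_pow_mul_add_inv (hp hi) hyn]
        exact hx.2 i (hi.trans n.lt_succ_self)
  refine le_trans (le_of_eq ?_) (measure_mono hsub)
  rw [measure_union' hdisj (measurableSet_digitZeroSet p _), measure_preimage_add_right, two_mul]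

/-- The points of `[0, 1)` whose digits `p i` all vanish. -/
def allDigitZeroSet (p : ℕ → ℕ) : Set ℝ := ⋂ n, digitZeroSet p n

theorem measurableSet_allDigitZeroSet (p : ℕ → ℕ) : MeasurableSet (allDigitZeroSet p) :=
  MeasurableSet.iInter (measurableSet_digitZeroSet p)

theorem volume_allDigitZeroSet {p : ℕ → ℕ} (hp : StrictMono p) (h0 : 0 < p 0) :
    volume (allDigitZeroSet p) = 0 := by
  have h : ∀ n, 2 ^ n * volume (digitZeroSet p n) ≤ 1 := by
    intro n
    induction n with
    | zero =>
      rw [pow_zero, one_mul]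
      refine (measure_mono fun x (hx : x ∈ digitZeroSet p 0) => hx.1).trans ?_
      simp
    | succ n ih =>
      rw [pow_succ, mul_assoc]
      exact (mul_le_mul_right (volume_digitZeroSet_succ_le hp h0 n) _).trans ih
  have h2 : ∀ n : ℕ, volume (allDigitZeroSet p) ≤ (2⁻¹ : ℝ≥0∞) ^ n := by
    intro n
    refine (measure_mono (iInter_subset _ n)).trans ?_
    rw [← ENNReal.inv_pow, ENNReal.le_inv_iff_mul_le, mul_comm]
    exact h n
  have h3 := ENNReal.tendsto_pow_atTop_nhds_zero_of_lt_one
    (ENNReal.inv_lt_one.2 ENNReal.one_lt_two)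
  exact le_antisymm (ge_of_tendsto' h3 h2) zero_le

theorem clearAllDigits_mem_allDigitZeroSet {p : ℕ → ℕ} (hp : StrictMono p) (h0 : 0 < p 0) {x : ℝ}
    (hx : x ∈ unitIco) : clearAllDigits p x ∈ allDigitZeroSet p :=
  mem_iInter.2 fun _ => ⟨clearAllDigits_mem_unitIco hp h0 hx,
    fun i _ => floor_clearAllDigits_emod_two hp i x⟩

/-! ### Herglotz integrals and singular factors -/

theorem continuous_circle_coe : Continuous fun ζ : Circle => (ζ : ℂ) := by
  fun_prop

theorem circle_sub_ne_zero (ζ : Circle) {z : ℂ} (hz : z ∈ openDisk) : (ζ : ℂ) - z ≠ 0 := by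
  intro h
  have : ‖(ζ : ℂ)‖ = ‖z‖ := by rw [sub_eq_zero.1 h]
  rw [Circle.norm_coe] at this
  rw [mem_ball_zero_iff] at hz
  linarith

theorem le_norm_circle_sub (ζ : Circle) (z : ℂ) : 1 - ‖z‖ ≤ ‖(ζ : ℂ) - z‖ := by
  have := norm_sub_norm_le (ζ : ℂ) z
  rwa [Circle.norm_coe] at this

theorem continuous_circle_herglotz {z : ℂ} (hz : z ∈ openDisk) :
    Continuous fun ζ : Circle => ((ζ : ℂ) + z) / ((ζ : ℂ) - z) :=
  (continuous_circle_coe.add continuous_const).div (continuous_circle_coe.sub continuous_const)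
    fun ζ => circle_sub_ne_zero ζ hz

theorem integrable_circle_herglotz (μ : Measure Circle) [IsFiniteMeasure μ] {z : ℂ}
    (hz : z ∈ openDisk) : Integrable (fun ζ : Circle => ((ζ : ℂ) + z) / ((ζ : ℂ) - z)) μ :=
  (continuous_circle_herglotz hz).integrable_of_hasCompactSupport
    (HasCompactSupport.of_compactSpace _)

theorem circle_herglotz_re_nonneg (ζ : Circle) {z : ℂ} (hz : z ∈ openDisk) :
    0 ≤ (((ζ : ℂ) + z) / ((ζ : ℂ) - z)).re := by
  have h := le_re_herglotzRieszKernel (c := 0) (R := 1) (z := ζ) (w := z)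
    (by simp [Circle.norm_coe]) hz
  simp only [sub_zero] at h
  refine le_trans ?_ h
  rw [mem_ball_zero_iff] at hz
  have := norm_nonneg z
  apply div_nonneg <;> linarith

theorem hasDerivAt_herglotz (ζ : Circle) {z : ℂ} (hz : z ∈ openDisk) :
    HasDerivAt (fun z => ((ζ : ℂ) + z) / ((ζ : ℂ) - z)) (2 * ζ / ((ζ : ℂ) - z) ^ 2) z := by
  have h1 : HasDerivAt (fun z => (ζ : ℂ) + z) 1 z := (hasDerivAt_id z).const_add _
  have h2 : HasDerivAt (fun z => (ζ : ℂ) - z) (-1) z := (hasDerivAt_id z).const_sub _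
  convert! h1.div h2 (circle_sub_ne_zero ζ hz) using 2
  ring

theorem differentiableOn_integral_herglotz (μ : Measure Circle) [IsFiniteMeasure μ] :
    DifferentiableOn ℂ (fun z => ∫ ζ : Circle, ((ζ : ℂ) + z) / ((ζ : ℂ) - z) ∂μ) openDisk := by
  intro z hz
  have hz1 : ‖z‖ < 1 := mem_ball_zero_iff.1 hz
  obtain ⟨r, hzr, hr1⟩ := exists_between hz1
  have hs : Metric.ball (0 : ℂ) r ∈ 𝓝 z := Metric.isOpen_ball.mem_nhds (mem_ball_zero_iff.2 hzr)
  have hsub : Metric.ball (0 : ℂ) r ⊆ openDisk := Metric.ball_subset_ball hr1.le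
  have key := hasDerivAt_integral_of_dominated_loc_of_deriv_le (μ := μ) (x₀ := z)
    (F := fun z (ζ : Circle) => ((ζ : ℂ) + z) / ((ζ : ℂ) - z))
    (F' := fun z ζ => 2 * ζ / ((ζ : ℂ) - z) ^ 2) (bound := fun _ => 2 / (1 - r) ^ 2) hs
    (by
      filter_upwards [hs] with w hw
      exact (integrable_circle_herglotz μ (hsub hw)).aestronglyMeasurable)
    (integrable_circle_herglotz μ hz)
    (by
      refine Continuous.aestronglyMeasurable ?_
      exact (continuous_const.mul continuous_circle_coe).div
        ((continuous_circle_coe.sub continuous_const).pow 2)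
        fun ζ => pow_ne_zero 2 (circle_sub_ne_zero ζ hz))
    (Eventually.of_forall fun ζ w hw => by
      have hw' : ‖w‖ < r := mem_ball_zero_iff.1 hw
      have := le_norm_circle_sub ζ w
      rw [norm_div, norm_mul, norm_pow, Circle.norm_coe, Complex.norm_ofNat, mul_one]
      have h1r : 0 < 1 - r := by linarith
      gcongr
      linarith)
    (integrable_const _)
    (Eventually.of_forall fun ζ w hw => hasDerivAt_herglotz ζ (hsub hw))
  exact key.2.differentiableAt.differentiableWithinAt

theorem differentiableOn_singularFactor (μ : Measure Circle) [IsFiniteMeasure μ] :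
    DifferentiableOn ℂ (singularFactor μ) openDisk :=
  (differentiableOn_integral_herglotz μ).neg.cexp

theorem norm_singularFactor (μ : Measure Circle) [IsFiniteMeasure μ] {z : ℂ} (hz : z ∈ openDisk) :
    ‖singularFactor μ z‖ = Real.exp (-∫ ζ : Circle, (((ζ : ℂ) + z) / ((ζ : ℂ) - z)).re ∂μ) := by
  rw [singularFactor, Complex.norm_exp, Complex.neg_re]
  congr 2
  exact (integral_re (integrable_circle_herglotz μ hz)).symm

theorem norm_singularFactor_le_one (μ : Measure Circle) [IsFiniteMeasure μ] {z : ℂ}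
    (hz : z ∈ openDisk) : ‖singularFactor μ z‖ ≤ 1 := by
  rw [norm_singularFactor μ hz, Real.exp_le_one_iff, neg_nonpos]
  exact integral_nonneg fun ζ => circle_herglotz_re_nonneg ζ hz

/-! ### Factors of image measures on the circle -/

/-- The parametrization `x ↦ exp (i (π - 2 π x))` of the circle; it maps `[0, 1)` to the arguments
`(-π, π]`. -/
noncomputable def circleParam (x : ℝ) : Circle := Circle.exp (Real.pi - 2 * Real.pi * x)

theorem continuous_circleParam : Continuous circleParam := by
  unfold circleParam
  fun_prop

theorem norm_circleParam_sub_le (x y : ℝ) :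
    ‖(circleParam x : ℂ) - circleParam y‖ ≤ 2 * Real.pi * |x - y| := by
  have h : (circleParam x : ℂ) =
      circleParam y * Complex.exp (Complex.I * ((2 * Real.pi * (y - x) : ℝ) : ℂ)) := by
    rw [circleParam, circleParam, Circle.coe_exp, Circle.coe_exp, ← Complex.exp_add]
    congr 1
    push_cast
    ring
  have h2 : (circleParam x : ℂ) - circleParam y =
      circleParam y * (Complex.exp (Complex.I * ((2 * Real.pi * (y - x) : ℝ) : ℂ)) - 1) := by
    rw [h]
    ring
  rw [h2, norm_mul, Circle.norm_coe, one_mul]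
  refine (Real.norm_exp_I_mul_ofReal_sub_one_le).trans (le_of_eq ?_)
  rw [Real.norm_eq_abs, abs_mul, abs_of_pos Real.two_pi_pos, abs_sub_comm]

theorem circleAverage_eq_integral_circleParam (f : ℂ → ℝ) :
    Real.circleAverage f 0 1 = ∫ x in unitIco, f (circleParam x) := by
  have hper : Function.Periodic (fun θ => f (circleMap 0 1 θ)) (2 * Real.pi) := fun θ => by
    simp only [periodic_circleMap 0 1 θ]
  have h := hper.intervalIntegral_add_eq 0 (-Real.pi)
  have h2 := intervalIntegral.integral_comp_sub_mul (a := 0) (b := 1)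
    (fun θ => f (circleMap 0 1 θ)) Real.two_pi_pos.ne' Real.pi
  rw [Real.circleAverage_def, ← zero_add (2 * Real.pi), h]
  rw [integral_Ico_eq_integral_Ioc, ← intervalIntegral.integral_of_le zero_le_one]
  have e1 : Real.pi - 2 * Real.pi * 1 = -Real.pi := by ring
  have e2 : Real.pi - 2 * Real.pi * 0 = -Real.pi + 2 * Real.pi := by ring
  rw [e1, e2] at h2
  rw [zero_add, ← h2]
  congr 1
  ext x
  rw [circleParam, Circle.coe_exp, circleMap, Complex.ofReal_one, one_mul, zero_add]

/-- This is the Poisson formula for the constant function `1`. -/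
theorem integral_circleParam_herglotz_re {z : ℂ} (hz : z ∈ openDisk) :
    ∫ x in unitIco, (((circleParam x : ℂ) + z) / ((circleParam x : ℂ) - z)).re = 1 := by
  have h := InnerProductSpace.HarmonicContOnCl.circleAverage_re_herglotzRieszKernel_smul
    (f := fun _ => (1 : ℝ)) (c := 0) (R := 1) (w := z) ?_ hz
  · rw [circleAverage_eq_integral_circleParam] at h
    simpa [herglotzRieszKernel] using h
  · exact ⟨fun x hx => InnerProductSpace.harmonicAt_const 1, continuousOn_const⟩

/-- The Poisson kernel is nonnegative, so its integral is monotone in the measure, and against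
normalized arclength it equals `1`. -/
theorem norm_inv_singularFactor_le {μ : Measure Circle} [IsFiniteMeasure μ] {c : ℝ≥0}
    (h : μ ≤ c • (volume.restrict unitIco).map circleParam) {z : ℂ} (hz : z ∈ openDisk) :
    ‖(singularFactor μ z)⁻¹‖ ≤ Real.exp c := by
  rw [norm_inv, norm_singularFactor μ hz, Real.exp_neg, inv_inv, Real.exp_le_exp]
  set σ := (volume.restrict unitIco).map circleParam
  have hcont : Continuous fun ζ : Circle => (((ζ : ℂ) + z) / ((ζ : ℂ) - z)).re :=
    Complex.continuous_re.comp (continuous_circle_herglotz hz)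
  calc ∫ ζ : Circle, (((ζ : ℂ) + z) / ((ζ : ℂ) - z)).re ∂μ
      ≤ ∫ ζ : Circle, (((ζ : ℂ) + z) / ((ζ : ℂ) - z)).re ∂(c • σ) :=
        integral_mono_measure h (Eventually.of_forall fun ζ => circle_herglotz_re_nonneg ζ hz)
          ((integrable_circle_herglotz (c • σ) hz).re)
    _ = c * 1 := by
        rw [integral_smul_nnreal_measure, integral_map continuous_circleParam.aemeasurable
          hcont.aestronglyMeasurable, integral_circleParam_herglotz_re hz]
        rfl
    _ = c := mul_one _

theorem norm_herglotz_sub_le (ζ ξ : Circle) {z : ℂ} {ρ : ℝ} (hz : ‖z‖ ≤ ρ) (hρ : ρ < 1) :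
    ‖((ζ : ℂ) + z) / ((ζ : ℂ) - z) - ((ξ : ℂ) + z) / ((ξ : ℂ) - z)‖ ≤
      2 * ‖(ζ : ℂ) - ξ‖ / (1 - ρ) ^ 2 := by
  have hzD : z ∈ openDisk := mem_ball_zero_iff.2 (hz.trans_lt hρ)
  have h1 := circle_sub_ne_zero ζ hzD
  have h2 := circle_sub_ne_zero ξ hzD
  have e : ((ζ : ℂ) + z) / ((ζ : ℂ) - z) - ((ξ : ℂ) + z) / ((ξ : ℂ) - z) =
      2 * z * (ξ - ζ) / ((ζ - z) * (ξ - z)) := by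
    field_simp
    ring
  have h1ρ : 0 < 1 - ρ := by linarith
  rw [e, norm_div, norm_mul, norm_mul, norm_mul, Complex.norm_ofNat, norm_sub_rev (ξ : ℂ), sq]
  have h3 := le_norm_circle_sub ζ z
  have h4 := le_norm_circle_sub ξ z
  gcongr
  · nlinarith [norm_nonneg ((ζ : ℂ) - ξ)]
  · linarith
  · linarith

/-- The law on the circle of `circleParam (Y x)` for `x` uniform in `[0, 1)`. -/
noncomputable def circleLaw (Y : ℝ → ℝ) : Measure Circle :=
  (volume.restrict unitIco).map (fun x => circleParam (Y x))

instance isFiniteMeasure_circleLaw (Y : ℝ → ℝ) : IsFiniteMeasure (circleLaw Y) := by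
  unfold circleLaw
  infer_instance

theorem integral_circleLaw {Y : ℝ → ℝ} (hY : Measurable Y) {z : ℂ} (hz : z ∈ openDisk) :
    ∫ ζ : Circle, ((ζ : ℂ) + z) / ((ζ : ℂ) - z) ∂circleLaw Y =
      ∫ x in unitIco, ((circleParam (Y x) : ℂ) + z) / ((circleParam (Y x) : ℂ) - z) :=
  integral_map (continuous_circleParam.measurable.comp hY).aemeasurable
    (continuous_circle_herglotz hz).aestronglyMeasurable

/-- Both laws are images of the same uniform variable, so the exponents can be compared pointwise.
The constant `4π` is the `2` of the kernel estimate times the `2π` of the parametrization, and the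
outer `2` comes from `|e^u - 1| ≤ 2 |u|` for `|u| ≤ 1`. -/
theorem norm_singularFactor_mul_inv_sub_one_le {X Y : ℝ → ℝ} (hX : Measurable X)
    (hY : Measurable Y) {d : ℝ} (hXY : ∀ x, |X x - Y x| ≤ d) {z : ℂ} {ρ : ℝ} (hz : ‖z‖ ≤ ρ)
    (hρ : ρ < 1) (hd : 4 * Real.pi * d / (1 - ρ) ^ 2 ≤ 1) :
    ‖singularFactor (circleLaw X) z * (singularFactor (circleLaw Y) z)⁻¹ - 1‖ ≤
      2 * (4 * Real.pi * d / (1 - ρ) ^ 2) := by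
  have hzD : z ∈ openDisk := mem_ball_zero_iff.2 (hz.trans_lt hρ)
  have hint : ∀ {Z : ℝ → ℝ}, Measurable Z → IntegrableOn
      (fun x => ((circleParam (Z x) : ℂ) + z) / ((circleParam (Z x) : ℂ) - z)) unitIco :=
    fun {Z} hZ => (integrable_circle_herglotz (circleLaw Z) hzD).comp_measurable
      (continuous_circleParam.measurable.comp hZ)
  rw [singularFactor, singularFactor, ← Complex.exp_neg, ← Complex.exp_add,
    integral_circleLaw hX hzD, integral_circleLaw hY hzD, neg_neg, neg_add_eq_sub,
    ← integral_sub (hint hY) (hint hX)]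
  have hb : ‖∫ x in unitIco, (((circleParam (Y x) : ℂ) + z) / ((circleParam (Y x) : ℂ) - z) -
      ((circleParam (X x) : ℂ) + z) / ((circleParam (X x) : ℂ) - z))‖ ≤
      4 * Real.pi * d / (1 - ρ) ^ 2 := by
    refine (norm_setIntegral_le_of_norm_le_const (C := 4 * Real.pi * d / (1 - ρ) ^ 2) (by simp)
      fun x _ => ?_).trans (by simp)
    refine (norm_herglotz_sub_le _ _ hz hρ).trans ?_
    have h1 := norm_circleParam_sub_le (Y x) (X x)
    rw [abs_sub_comm] at h1
    have h2 := hXY x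
    have h3 := Real.pi_pos
    refine div_le_div_of_nonneg_right ?_ (by positivity)
    calc 2 * ‖(circleParam (Y x) : ℂ) - circleParam (X x)‖
        ≤ 2 * (2 * Real.pi * |X x - Y x|) := by gcongr
      _ ≤ 2 * (2 * Real.pi * d) := by gcongr
      _ = 4 * Real.pi * d := by ring
  exact (Complex.norm_exp_sub_one_le (hb.trans hd)).trans (by linarith)

theorem circleLaw_clearDigits_le {p : ℕ → ℕ} (hp : ∀ n, 0 < p n) (n : ℕ) :
    circleLaw (clearDigits p n) ≤ (2 ^ n : ℝ≥0) • (volume.restrict unitIco).map circleParam := by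
  have h := Measure.map_mono (map_clearDigits_le hp n) continuous_circleParam.measurable
  rw [Measure.map_map continuous_circleParam.measurable (measurable_clearDigits p n),
    Measure.map_smul] at h
  refine h.trans (le_of_eq ?_)
  ext s _
  simp [ENNReal.smul_def]

theorem circleLaw_clearAllDigits_mutuallySingular {p : ℕ → ℕ} (hp : StrictMono p) (h0 : 0 < p 0) :
    circleLaw (clearAllDigits p) ⟂ₘ circleArcMeasure := by
  set S := allDigitZeroSet p
  have hYm : Measurable fun x => circleParam (clearAllDigits p x) :=
    continuous_circleParam.measurable.comp (measurable_clearAllDigits p)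
  -- Composed with `Complex.arg`, this inverts `circleParam` on `[0, 1)`, so the separating set of
  -- the circle is a preimage of the null digit set.
  set τ : ℝ → ℝ := fun t => (Real.pi - t) / (2 * Real.pi) with hτ
  have hτm : Measurable τ := (measurable_const.sub measurable_id).div_const _
  have hpi := Real.pi_pos
  have hmc : Measurable fun ζ : Circle => (ζ : ℂ) := continuous_circle_coe.measurable
  have hargm : Measurable fun ζ : Circle => τ (Complex.arg ζ) :=
    hτm.comp (Complex.measurable_arg.comp hmc)
  have hB : MeasurableSet ((fun ζ : Circle => τ (Complex.arg ζ)) ⁻¹' S) :=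
    hargm (measurableSet_allDigitZeroSet p)
  refine Measure.MutuallySingular.mk (s := ((fun ζ : Circle => τ (Complex.arg ζ)) ⁻¹' S)ᶜ)
    (t := (fun ζ : Circle => τ (Complex.arg ζ)) ⁻¹' S) ?_ ?_ (by simp)
  · rw [circleLaw, Measure.map_apply hYm hB.compl, Measure.restrict_apply (hYm hB.compl)]
    convert! measure_empty (μ := (volume : Measure ℝ))
    refine eq_empty_of_forall_notMem fun x hx => hx.1 ?_
    have hI := clearAllDigits_mem_unitIco hp h0 hx.2
    have hS := clearAllDigits_mem_allDigitZeroSet hp h0 hx.2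
    have harg : Complex.arg (circleParam (clearAllDigits p x)) =
        Real.pi - 2 * Real.pi * clearAllDigits p x :=
      Circle.arg_exp (by nlinarith [hI.2]) (by nlinarith [hI.1])
    have : τ (Complex.arg (circleParam (clearAllDigits p x))) = clearAllDigits p x := by
      rw [harg, hτ]
      field_simp
      ring
    simpa [this] using hS
  · rw [circleArcMeasure, Measure.smul_apply, Measure.map_apply Circle.exp.continuous.measurable hB,
      Measure.restrict_apply (Circle.exp.continuous.measurable hB)]
    have hsub : Circle.exp ⁻¹' ((fun ζ : Circle => τ (Complex.arg ζ)) ⁻¹' S) ∩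
        Ioc (-Real.pi) Real.pi ⊆ τ ⁻¹' S := by
      rintro t ⟨ht, htI⟩
      rw [mem_preimage, mem_preimage, Circle.arg_exp htI.1 htI.2] at ht
      exact ht
    have himg : τ ⁻¹' S ⊆ (fun x => Real.pi - 2 * Real.pi * x) '' S := by
      intro t ht
      refine ⟨τ t, ht, ?_⟩
      simp only [hτ]
      field_simp
      ring
    have hnull : volume ((fun x => Real.pi - 2 * Real.pi * x) '' S) = 0 := by
      refine addHaar_image_eq_zero_of_differentiableOn_of_addHaar_eq_zero volume
        (fun x _ => ?_) (volume_allDigitZeroSet hp h0)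
      exact (by fun_prop : DifferentiableAt ℝ (fun x : ℝ => Real.pi - 2 * Real.pi * x)
        x).differentiableWithinAt
    rw [measure_mono_null (hsub.trans himg) hnull, smul_zero]

theorem isSingularInner_singularFactor_clearAllDigits {p : ℕ → ℕ} (hp : StrictMono p)
    (h0 : 0 < p 0) : IsSingularInner (singularFactor (circleLaw (clearAllDigits p))) := by
  refine ⟨circleLaw (clearAllDigits p), inferInstance, ?_,
    circleLaw_clearAllDigits_mutuallySingular hp h0, fun _ _ => rfl⟩
  have hYm : Measurable fun x => circleParam (clearAllDigits p x) :=
    continuous_circleParam.measurable.comp (measurable_clearAllDigits p)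
  rw [circleLaw, Ne, Measure.map_eq_zero_iff hYm.aemeasurable, Measure.restrict_eq_zero]
  simp

/-! ### Circle averages and dilations -/

theorem norm_circleAverage_le {f : ℂ → ℂ} {R C : ℝ} (h : ∀ z ∈ Metric.sphere (0 : ℂ) |R|, ‖f z‖ ≤ C) :
    ‖Real.circleAverage f 0 R‖ ≤ C := by
  have hpi := Real.two_pi_pos
  have := intervalIntegral.norm_integral_le_of_norm_le_const (a := 0) (b := 2 * Real.pi) (C := C)
    (f := fun θ => f (circleMap 0 R θ)) fun θ _ => h _ (circleMap_mem_sphere' 0 R θ)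
  rw [sub_zero, abs_of_pos hpi] at this
  rw [Real.circleAverage_def, norm_smul, norm_inv, Real.norm_eq_abs, abs_of_pos hpi,
    inv_mul_le_iff₀ hpi]
  linarith

theorem sphere_abs_subset_openDisk {r : ℝ} (h0 : 0 ≤ r) (h1 : r < 1) :
    Metric.sphere (0 : ℂ) |r| ⊆ openDisk := fun z hz => by
  rw [mem_sphere_zero_iff_norm, abs_of_nonneg h0] at hz
  rw [mem_ball_zero_iff, hz]
  exact h1

theorem circleIntegrable_of_continuousOn_openDisk {E : Type*} [NormedAddCommGroup E] {f : ℂ → E}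
    (hf : ContinuousOn f openDisk) {r : ℝ} (h0 : 0 ≤ r) (h1 : r < 1) : CircleIntegrable f 0 r :=
  (hf.mono (sphere_abs_subset_openDisk h0 h1)).circleIntegrable'

/-- Dilations of the disk are self-adjoint with respect to the pairing over circles. -/
theorem circleAverage_dilation_mul_conj {f g : ℂ → ℂ} (hf : DifferentiableOn ℂ f openDisk)
    (hg : DifferentiableOn ℂ g openDisk) {ρ r : ℝ} (hρ0 : 0 < ρ) (hρ1 : ρ < 1) (hr0 : 0 < r)
    (hr1 : r < 1) :
    Real.circleAverage (fun z => f (ρ * z) * conj (g z)) 0 r =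
      Real.circleAverage (fun z => f z * conj (g (ρ * z))) 0 r := by
  -- `Φ` is holomorphic near the closed annulus `ρ r ≤ |w| ≤ r`, where `|ρ r² / w| ≤ r < 1`, so its
  -- means over the two boundary circles agree. By `z * conj z = r²`, it equals `f z * conj (g (ρ
  -- z))` at `w = z` and `f (ρ z) * conj (g z)` at `w = ρ z` when `|z| = r`.
  set Φ : ℂ → ℂ := fun w => f w * conj (g (conj (ρ * r ^ 2 / w))) with hΦ
  have hρr : 0 < ρ * r := mul_pos hρ0 hr0
  have hmul : ∀ z : ℂ, z * conj z = (‖z‖ ^ 2 : ℝ) := fun z => by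
    rw [Complex.mul_conj, Complex.normSq_eq_norm_sq]
  have hdiff : ∀ w ∈ Metric.closedBall (0 : ℂ) r \ Metric.ball 0 (ρ * r),
      DifferentiableAt ℂ Φ w := by
    rintro w ⟨hw1, hw2⟩
    rw [mem_closedBall_zero_iff] at hw1
    rw [mem_ball_zero_iff, not_lt] at hw2
    have hw0 : w ≠ 0 := norm_pos_iff.1 (hρr.trans_le hw2)
    have hfw : DifferentiableAt ℂ f w := hf.differentiableAt
      (Metric.isOpen_ball.mem_nhds (mem_ball_zero_iff.2 (hw1.trans_lt hr1)))
    have hu : ‖(ρ * r ^ 2 / w : ℂ)‖ < 1 := by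
      rw [norm_div, norm_mul, norm_pow, Complex.norm_real, Complex.norm_real,
        Real.norm_of_nonneg hρ0.le, Real.norm_of_nonneg hr0.le, div_lt_one (norm_pos_iff.2 hw0)]
      refine lt_of_lt_of_le ?_ hw2
      nlinarith
    have hgw : DifferentiableAt ℂ g (conj (ρ * r ^ 2 / w)) := hg.differentiableAt
      (Metric.isOpen_ball.mem_nhds (by rwa [mem_ball_zero_iff, RCLike.norm_conj]))
    have h2 := hgw.conj_conj
    rw [Complex.conj_conj] at h2
    have h3 : DifferentiableAt ℂ (fun w : ℂ => (ρ * r ^ 2 / w : ℂ)) w :=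
      (differentiableAt_const _).div differentiableAt_id hw0
    exact hfw.mul (h2.comp w h3)
  have hcirc := Complex.circleIntegral_sub_center_inv_smul_eq_of_differentiable_on_annulus_off_countable
    hρr (by nlinarith : ρ * r ≤ r) (countable_empty)
    (fun w hw => (hdiff w hw).continuousAt.continuousWithinAt)
    (fun w hw => hdiff w ⟨Metric.ball_subset_closedBall hw.1.1,
      fun h => hw.1.2 (Metric.ball_subset_closedBall h)⟩)
  have havg : Real.circleAverage Φ 0 r = Real.circleAverage Φ 0 (ρ * r) := by
    rw [Real.circleAverage_eq_circleIntegral hr0.ne', Real.circleAverage_eq_circleIntegral hρr.ne',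
      hcirc]
  have hright : Real.circleAverage (fun z => f z * conj (g (ρ * z))) 0 r =
      Real.circleAverage Φ 0 r := by
    refine Real.circleAverage_congr_sphere fun z hz => ?_
    rw [mem_sphere_zero_iff_norm, abs_of_pos hr0] at hz
    have hz0 : z ≠ 0 := norm_pos_iff.1 (hz ▸ hr0)
    have h := hmul z
    rw [hz] at h
    have : conj (ρ * r ^ 2 / z : ℂ) = ρ * z := by
      rw [← Complex.conj_conj (ρ * z : ℂ)]
      congr 1
      rw [div_eq_iff hz0, map_mul, Complex.conj_ofReal, mul_assoc, mul_comm (conj z), h]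
      push_cast
      rfl
    simp only [hΦ, this]
  have hleft : Real.circleAverage (fun z => f (ρ * z) * conj (g z)) 0 r =
      Real.circleAverage Φ 0 (ρ * r) := by
    have h1 : Real.circleAverage (fun z => f (ρ * z) * conj (g z)) 0 r =
        Real.circleAverage (fun z => Φ (ρ * z)) 0 r := by
      refine Real.circleAverage_congr_sphere fun z hz => ?_
      rw [mem_sphere_zero_iff_norm, abs_of_pos hr0] at hz
      have hz0 : z ≠ 0 := norm_pos_iff.1 (hz ▸ hr0)
      have hρ : (ρ : ℂ) ≠ 0 := Complex.ofReal_ne_zero.2 hρ0.ne'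
      have h := hmul z
      rw [hz] at h
      have : conj (ρ * r ^ 2 / (ρ * z) : ℂ) = z := by
        rw [← Complex.conj_conj z]
        congr 1
        rw [Complex.conj_conj, mul_div_mul_left _ _ hρ, div_eq_iff hz0, mul_comm (conj z), h]
        push_cast
        rfl
      simp only [hΦ, this]
    rw [h1, Real.circleAverage_eq_circleAverage_zero_one (R := r),
      Real.circleAverage_eq_circleAverage_zero_one (R := ρ * r)]
    simp only [add_zero, Complex.ofReal_mul, mul_assoc]
  rw [hleft, hright, havg]

/-! ### The Szegő kernel and the estimate in the model space -/

/-- The Szegő kernel of the disk at `w`. -/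
noncomputable def szegoKernel (w z : ℂ) : ℂ := (1 - conj w * z)⁻¹

theorem le_norm_one_sub_conj_mul (w : ℂ) {z : ℂ} (hz : z ∈ openDisk) :
    1 - ‖w‖ ≤ ‖1 - conj w * z‖ := by
  have h := norm_sub_norm_le (1 : ℂ) (conj w * z)
  rw [norm_one, norm_mul, RCLike.norm_conj] at h
  have hz1 : ‖z‖ < 1 := mem_ball_zero_iff.1 hz
  nlinarith [norm_nonneg w]

theorem differentiableOn_szegoKernel {w : ℂ} (hw : w ∈ openDisk) :
    DifferentiableOn ℂ (szegoKernel w) openDisk := by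
  refine DifferentiableOn.inv (by fun_prop) fun z hz h => ?_
  have h1 := le_norm_one_sub_conj_mul w hz
  have hw1 : ‖w‖ < 1 := mem_ball_zero_iff.1 hw
  rw [h, norm_zero] at h1
  linarith

theorem norm_szegoKernel_le {w z : ℂ} (hw : w ∈ openDisk) (hz : z ∈ openDisk) :
    ‖szegoKernel w z‖ ≤ (1 - ‖w‖)⁻¹ := by
  have hw1 : ‖w‖ < 1 := mem_ball_zero_iff.1 hw
  rw [szegoKernel, norm_inv]
  exact inv_anti₀ (by linarith) (le_norm_one_sub_conj_mul w hz)

/-- On `|z| = r` one has `conj z = r² / z`, which turns the pairing into the Cauchy integral at `r²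
w`. -/
theorem circleAverage_mul_conj_szegoKernel {f : ℂ → ℂ} (hf : DifferentiableOn ℂ f openDisk) {w : ℂ}
    (hw : w ∈ openDisk) {r : ℝ} (hr0 : 0 < r) (hr1 : r < 1) :
    Real.circleAverage (fun z => f z * conj (szegoKernel w z)) 0 r = f (r ^ 2 * w) := by
  have hw1 : ‖w‖ < 1 := mem_ball_zero_iff.1 hw
  have hcl : DiffContOnCl ℂ f (Metric.ball 0 |r|) :=
    hf.diffContOnCl_ball (Metric.closedBall_subset_ball (by rwa [abs_of_pos hr0]))
  have hmem : (r ^ 2 * w : ℂ) ∈ Metric.ball (0 : ℂ) |r| := by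
    rw [mem_ball_zero_iff, abs_of_pos hr0, norm_mul, norm_pow, Complex.norm_real,
      Real.norm_of_nonneg hr0.le]
    nlinarith [norm_nonneg w]
  rw [← hcl.circleAverage_smul_div hmem]
  refine Real.circleAverage_congr_sphere fun z hz => ?_
  rw [mem_sphere_zero_iff_norm, abs_of_pos hr0] at hz
  have hz0 : z ≠ 0 := norm_pos_iff.1 (hz ▸ hr0)
  have h : z * conj z = (r ^ 2 : ℂ) := by
    rw [Complex.mul_conj, Complex.normSq_eq_norm_sq, hz]
    push_cast
    rfl
  have e : (z - r ^ 2 * w : ℂ) = z * (1 - w * conj z) := by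
    rw [← h]
    ring
  simp only [szegoKernel, sub_zero, smul_eq_mul, map_inv₀, map_sub, map_one, map_mul,
    Complex.conj_conj]
  rw [e, div_mul_eq_div_div, div_self hz0, one_div, mul_comm]

theorem mem_hardySpace_of_norm_le {h : ℂ → ℂ} (hd : DifferentiableOn ℂ h openDisk) {N : ℝ}
    (hN : ∀ z ∈ openDisk, ‖h z‖ ≤ N) : h ∈ hardySpace := by
  refine ⟨hd, N ^ 2, fun r hr => ?_⟩
  refine Real.circleAverage_mono_on_of_le_circle
    (circleIntegrable_of_continuousOn_openDisk (hd.continuousOn.norm.pow 2) hr.1 hr.2)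
    fun z hz => ?_
  exact pow_le_pow_left₀ (norm_nonneg _) (hN z (sphere_abs_subset_openDisk hr.1 hr.2 hz)) 2

/-- The global bound `M` of `g` meets only the small difference `f z - f (ρ z)`. The remaining part
is paired with the dilate of `g`, which sees only `|z| ≤ ρ`. -/
theorem norm_circleAverage_mul_conj_le {f g : ℂ → ℂ} (hf : DifferentiableOn ℂ f openDisk)
    (hg : DifferentiableOn ℂ g openDisk) {ρ r B η M ε : ℝ} (hρ0 : 0 < ρ) (hρ1 : ρ < 1)
    (hr0 : 0 < r) (hr1 : r < 1) (hB : ∀ z ∈ openDisk, ‖f z‖ ≤ B)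
    (hη : ∀ z ∈ openDisk, ‖f z - f (ρ * z)‖ ≤ η) (hM : ∀ z ∈ openDisk, ‖g z‖ ≤ M)
    (hε : ∀ z, ‖z‖ ≤ ρ → ‖g z‖ ≤ ε) :
    ‖Real.circleAverage (fun z => f z * conj (g z)) 0 r‖ ≤ η * M + B * ε := by
  have hmaps : MapsTo (fun z : ℂ => (ρ : ℂ) * z) openDisk (Metric.ball 0 ρ) := fun z hz => by
    have hz1 : ‖z‖ < 1 := mem_ball_zero_iff.1 hz
    rw [mem_ball_zero_iff, norm_mul, Complex.norm_real, Real.norm_of_nonneg hρ0.le]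
    nlinarith
  have hfρ : DifferentiableOn ℂ (fun z => f (ρ * z)) openDisk :=
    hf.comp (by fun_prop) fun z hz => Metric.ball_subset_ball hρ1.le (hmaps hz)
  have hgc : ContinuousOn (fun z => conj (g z)) openDisk :=
    Complex.continuous_conj.comp_continuousOn hg.continuousOn
  have hsplit : Real.circleAverage (fun z => f z * conj (g z)) 0 r =
      Real.circleAverage (fun z => (f z - f (ρ * z)) * conj (g z)) 0 r +
        Real.circleAverage (fun z => f (ρ * z) * conj (g z)) 0 r := by
    rw [← Real.circleAverage_fun_add]
    · congr 1
      ext z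
      ring
    · exact circleIntegrable_of_continuousOn_openDisk
        ((hf.continuousOn.sub hfρ.continuousOn).mul hgc) hr0.le hr1
    · exact circleIntegrable_of_continuousOn_openDisk (hfρ.continuousOn.mul hgc) hr0.le hr1
  rw [hsplit, circleAverage_dilation_mul_conj hf hg hρ0 hρ1 hr0 hr1]
  have hS := sphere_abs_subset_openDisk hr0.le hr1
  have h0 : (0 : ℂ) ∈ openDisk := Metric.mem_ball_self one_pos
  have hη0 : 0 ≤ η := (norm_nonneg _).trans (hη 0 h0)
  have hB0 : 0 ≤ B := (norm_nonneg _).trans (hB 0 h0)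
  refine (norm_add_le _ _).trans (add_le_add ?_ ?_)
  · refine norm_circleAverage_le fun z hz => ?_
    rw [norm_mul, RCLike.norm_conj]
    exact mul_le_mul (hη z (hS hz)) (hM z (hS hz)) (norm_nonneg _) hη0
  · refine norm_circleAverage_le fun z hz => ?_
    rw [norm_mul, RCLike.norm_conj]
    exact mul_le_mul (hB z (hS hz))
      (hε _ (mem_ball_zero_iff.1 (hmaps (hS hz))).le) (norm_nonneg _) hB0

/-- Here `h` stands for a bounded approximate inverse of `θ`. Since `θ h k_w` is orthogonal to `f`,
pairing `f` with `(θ h - 1) k_w` leaves `-f w` in the limit; the kernel adds the factor `(1 -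
‖w‖)⁻¹`. -/
theorem norm_le_of_mem_modelSpace {θ h f : ℂ → ℂ} (hθ : DifferentiableOn ℂ θ openDisk)
    (hh : DifferentiableOn ℂ h openDisk) {N : ℝ} (hN : ∀ z ∈ openDisk, ‖h z‖ ≤ N)
    (hf : f ∈ modelSpace θ) {ρ B η M ε : ℝ} (hρ0 : 0 < ρ) (hρ1 : ρ < 1)
    (hB : ∀ z ∈ openDisk, ‖f z‖ ≤ B) (hη : ∀ z ∈ openDisk, ‖f z - f (ρ * z)‖ ≤ η)
    (hM : ∀ z ∈ openDisk, ‖θ z * h z - 1‖ ≤ M) (hε : ∀ z, ‖z‖ ≤ ρ → ‖θ z * h z - 1‖ ≤ ε) {w : ℂ}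
    (hw : w ∈ openDisk) : ‖f w‖ ≤ (η * M + B * ε) * (1 - ‖w‖)⁻¹ := by
  have hfd : DifferentiableOn ℂ f openDisk := hf.1.1
  have hk := differentiableOn_szegoKernel hw
  have hw1 : ‖w‖ < 1 := mem_ball_zero_iff.1 hw
  have hN0 : 0 ≤ N := (norm_nonneg _).trans (hN w hw)
  have hM0 : 0 ≤ M := (norm_nonneg _).trans (hM w hw)
  have hε0 : 0 ≤ ε := (norm_nonneg _).trans (hε 0 (by simpa using hρ0.le))
  set g : ℂ → ℂ := fun z => (θ z * h z - 1) * szegoKernel w z with hg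
  have hgd : DifferentiableOn ℂ g openDisk := ((hθ.mul hh).sub_const 1).mul hk
  have hhk : (fun z => h z * szegoKernel w z) ∈ hardySpace :=
    mem_hardySpace_of_norm_le (N := N * (1 - ‖w‖)⁻¹) (hh.mul hk) fun z hz => by
      rw [norm_mul]
      exact mul_le_mul (hN z hz) (norm_szegoKernel_le hw hz) (norm_nonneg _) hN0
  have hconj : ∀ {u : ℂ → ℂ}, DifferentiableOn ℂ u openDisk →
      ContinuousOn (fun z => f z * conj (u z)) openDisk := fun hu =>
    hfd.continuousOn.mul (Complex.continuous_conj.comp_continuousOn hu.continuousOn)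
  have hIoo : Ioo (0 : ℝ) 1 ∈ 𝓝[<] (1 : ℝ) := Ioo_mem_nhdsLT one_pos
  have hlim1 : Tendsto (fun r : ℝ => Real.circleAverage
      (fun z => f z * conj (θ z * (h z * szegoKernel w z))) 0 r) (𝓝[<] 1) (𝓝 0) := hf.2 _ hhk
  have hlim2 : Tendsto (fun r : ℝ => f (r ^ 2 * w)) (𝓝[<] 1) (𝓝 (f w)) := by
    have hc : ContinuousAt f w := (hfd.differentiableAt (Metric.isOpen_ball.mem_nhds hw)).continuousAt
    have hi : Tendsto (fun r : ℝ => (r ^ 2 * w : ℂ)) (𝓝[<] 1) (𝓝 w) := by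
      have : Continuous fun r : ℝ => (r ^ 2 * w : ℂ) := by fun_prop
      have h1 := this.tendsto 1
      simp only [Complex.ofReal_one, one_pow, one_mul] at h1
      exact h1.mono_left nhdsWithin_le_nhds
    exact hc.tendsto.comp hi
  have hlim : Tendsto (fun r : ℝ => ‖Real.circleAverage (fun z => f z * conj (g z)) 0 r‖) (𝓝[<] 1)
      (𝓝 ‖f w‖) := by
    have h3 := (hlim1.sub hlim2).norm
    rw [zero_sub, norm_neg] at h3
    refine h3.congr' ?_
    filter_upwards [hIoo] with r hr
    rw [← circleAverage_mul_conj_szegoKernel hfd hw hr.1 hr.2, ← Real.circleAverage_fun_sub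
      (circleIntegrable_of_continuousOn_openDisk
        (hconj (u := fun z => θ z * (h z * szegoKernel w z)) (hθ.mul (hh.mul hk))) hr.1.le hr.2)
      (circleIntegrable_of_continuousOn_openDisk (hconj hk) hr.1.le hr.2)]
    congr 2
    ext z
    simp only [hg, map_mul, map_sub, map_one]
    ring
  refine le_of_tendsto hlim ?_
  filter_upwards [hIoo] with r hr
  refine (norm_circleAverage_mul_conj_le hfd hgd hρ0 hρ1 hr.1 hr.2 hB hη
    (M := M * (1 - ‖w‖)⁻¹) (ε := ε * (1 - ‖w‖)⁻¹) (fun z hz => ?_) fun z hz => ?_).trans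
    (le_of_eq (by ring))
  · rw [hg, norm_mul]
    exact mul_le_mul (hM z hz) (norm_szegoKernel_le hw hz) (norm_nonneg _) hM0
  · rw [hg, norm_mul]
    exact mul_le_mul (hε z hz) (norm_szegoKernel_le hw (mem_ball_zero_iff.2 (hz.trans_lt hρ1)))
      (norm_nonneg _) hε0

/-! ### Choice of scales and conclusion -/

theorem exists_bounds_of_mem_analyticModulusSpace {ω : ℝ≥0 → ℝ≥0} (hω : Monotone ω) {f : ℂ → ℂ}
    (hf : f ∈ analyticModulusSpace ω) :
    ∃ B C : ℝ, 0 ≤ C ∧ (∀ z ∈ openDisk, ‖f z‖ ≤ B) ∧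
      ∀ δ : ℝ≥0, δ ≤ 1 → ∀ z ∈ openDisk, ‖f z - f ((1 - δ : ℝ) * z)‖ ≤ C * ω δ := by
  obtain ⟨_, F, hF, hFf, C, hC⟩ := hf
  obtain ⟨B, hB⟩ := (isCompact_closedBall (0 : ℂ) 1).exists_bound_of_continuousOn hF
  have hsub : openDisk ⊆ closedDisk := Metric.ball_subset_closedBall
  refine ⟨B, |C|, abs_nonneg C,
    fun z hz => hFf hz ▸ hB z (hsub hz), fun δ hδ z hz => ?_⟩
  have hδ_le : (δ : ℝ) ≤ 1 := by exact_mod_cast hδ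
  have hz1 : ‖z‖ < 1 := mem_ball_zero_iff.1 hz
  have hδz : ((1 - δ : ℝ) : ℂ) * z ∈ openDisk := by
    rw [mem_ball_zero_iff, norm_mul, Complex.norm_real, Real.norm_of_nonneg (by linarith)]
    nlinarith [norm_nonneg z, mul_nonneg δ.coe_nonneg (norm_nonneg z)]
  by_cases hne : z = ((1 - δ : ℝ) : ℂ) * z
  · rw [← hne, sub_self, norm_zero]
    positivity
  rw [← hFf hz, ← hFf hδz]
  refine (hC z (hsub hz) _ (hsub hδz) hne).trans ?_
  have hdist : nndist z (((1 - δ : ℝ) : ℂ) * z) ≤ δ := by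
    rw [← NNReal.coe_le_coe, coe_nndist, dist_eq_norm]
    have : z - ((1 - δ : ℝ) : ℂ) * z = ((δ : ℝ) : ℂ) * z := by
      push_cast
      ring
    rw [this, norm_mul, Complex.norm_real, Real.norm_of_nonneg δ.coe_nonneg]
    exact mul_le_of_le_one_right δ.2 hz1.le
  have hωd : (ω (nndist z (((1 - δ : ℝ) : ℂ) * z)) : ℝ) ≤ ω δ := NNReal.coe_le_coe.2 (hω hdist)
  exact mul_le_mul (le_abs_self C) hωd (NNReal.coe_nonneg _) (abs_nonneg C)

theorem exists_pos_lt_one_mul_le {ω : ℝ≥0 → ℝ≥0} (hω : Continuous ω) (h0 : ω 0 = 0) (K : ℝ) {ε : ℝ}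
    (hε : 0 < ε) : ∃ δ : ℝ≥0, 0 < δ ∧ δ < 1 ∧ (ω δ : ℝ) * K ≤ ε := by
  have hc : Continuous fun δ : ℝ≥0 => (ω δ : ℝ) * K :=
    (NNReal.continuous_coe.comp hω).mul continuous_const
  have ht : Tendsto (fun δ : ℝ≥0 => (ω δ : ℝ) * K) (𝓝[>] 0) (𝓝 0) := by
    have := hc.tendsto 0
    simp only [h0, NNReal.coe_zero, zero_mul] at this
    exact this.mono_left nhdsWithin_le_nhds
  have h1 : ∀ᶠ δ : ℝ≥0 in 𝓝[>] 0, δ ∈ Ioo (0 : ℝ≥0) 1 := Ioo_mem_nhdsGT one_pos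
  obtain ⟨δ, hδ, hδ2⟩ := (h1.and (ht.eventually_le_const hε)).exists
  exact ⟨δ, hδ.1, hδ.2, hδ2⟩

theorem zero_mem_modelSpace_of_eqOn {f θ : ℂ → ℂ} (hf : EqOn f 0 openDisk) : f ∈ modelSpace θ := by
  have hd : DifferentiableOn ℂ f openDisk := (differentiableOn_const 0).congr hf
  refine ⟨mem_hardySpace_of_norm_le hd (N := 0) fun z hz => by simp [hf hz], fun h _ => ?_⟩
  refine Tendsto.congr' ?_ tendsto_const_nhds
  filter_upwards [Ioo_mem_nhdsLT (one_pos : (0 : ℝ) < 1)] with r hr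
  rw [Real.circleAverage_congr_sphere (f₂ := fun _ => (0 : ℂ)), Real.circleAverage_const]
  intro z hz
  simp [hf (sphere_abs_subset_openDisk hr.1.le hr.2 hz)]

theorem zero_mem_analyticModulusSpace_of_eqOn {f : ℂ → ℂ} (ω : ℝ≥0 → ℝ≥0)
    (hf : EqOn f 0 openDisk) : f ∈ analyticModulusSpace ω :=
  ⟨(differentiableOn_const 0).congr hf, 0, continuousOn_const, hf.symm, 0, by simp⟩

theorem mainTheorem2 (ω : ℝ≥0 → ℝ≥0) (hω : IsModulusOfContinuity ω) :
    ∃ θ : ℂ → ℂ, IsSingularInner θ ∧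
      analyticModulusSpace ω ∩ modelSpace θ = {f : ℂ → ℂ | EqOn f 0 openDisk} := by
  -- The factor `exp (2 ^ n) + 1` is the global bound of `θ / θ_n - 1`. It does not involve `p`, so
  -- there is no circularity in fixing `δ` first.
  have hδ : ∀ n : ℕ, ∃ δ : ℝ≥0, 0 < δ ∧ δ < 1 ∧
      (ω δ : ℝ) * (Real.exp ((2 ^ n : ℝ≥0) : ℝ) + 1) ≤ 1 / ((n : ℝ) + 1) := fun n =>
    exists_pos_lt_one_mul_le hω.continuous hω.map_zero _ (by positivity)
  choose δ hδ0 hδ1 hδω using hδ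
  -- This is the exponent bound for the displacement `2 * (2 ^ k)⁻¹` and radius `ρ = 1 - δ n`. Every
  -- large `k` satisfies it, so a strictly increasing `p` can be extracted.
  have hp : ∀ n : ℕ, ∀ᶠ k : ℕ in atTop, 0 < k ∧
      4 * Real.pi * (2 * (2 ^ k)⁻¹) / (1 - (1 - (δ n : ℝ))) ^ 2 ≤ 1 / ((n : ℝ) + 1) := by
    intro n
    refine (eventually_gt_atTop 0).and ?_
    have h1 : Tendsto (fun k : ℕ => ((2 : ℝ) ^ k)⁻¹) atTop (𝓝 0) :=
      tendsto_inv_atTop_zero.comp (tendsto_pow_atTop_atTop_of_one_lt one_lt_two)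
    have h2 := (((h1.const_mul 2).const_mul (4 * Real.pi)).div_const
      ((1 - (1 - (δ n : ℝ))) ^ 2))
    simp only [mul_zero, zero_div] at h2
    exact h2.eventually_le_const (by positivity)
  obtain ⟨p, hpm, hpp⟩ := extraction_forall_of_eventually hp
  have hp0 : ∀ n, 0 < p n := fun n => (hpp n).1
  set θ := singularFactor (circleLaw (clearAllDigits p))
  refine ⟨θ, isSingularInner_singularFactor_clearAllDigits hpm (hp0 0), ?_⟩
  refine Subset.antisymm ?_ fun f hf =>
    ⟨zero_mem_analyticModulusSpace_of_eqOn ω hf, zero_mem_modelSpace_of_eqOn hf⟩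
  rintro f ⟨hfω, hfθ⟩ w hw
  obtain ⟨B, C, hC0, hB, hC⟩ := exists_bounds_of_mem_analyticModulusSpace hω.monotone hfω
  have hbound : ∀ n : ℕ, ‖f w‖ ≤ (C + 2 * B) * (1 - ‖w‖)⁻¹ * (1 / ((n : ℝ) + 1)) := by
    intro n
    set h : ℂ → ℂ := fun z => (singularFactor (circleLaw (clearDigits p n)) z)⁻¹
    have hne : ∀ z, singularFactor (circleLaw (clearDigits p n)) z ≠ 0 := fun z =>
      Complex.exp_ne_zero _
    have hhd : DifferentiableOn ℂ h openDisk :=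
      (differentiableOn_singularFactor _).inv fun z _ => hne z
    have hhN : ∀ z ∈ openDisk, ‖h z‖ ≤ Real.exp ((2 ^ n : ℝ≥0) : ℝ) := fun z hz =>
      norm_inv_singularFactor_le (circleLaw_clearDigits_le hp0 n) hz
    have hδn : (0 : ℝ) < δ n := NNReal.coe_pos.2 (hδ0 n)
    have hδn1 : (δ n : ℝ) < 1 := by exact_mod_cast hδ1 n
    have hM : ∀ z ∈ openDisk, ‖θ z * h z - 1‖ ≤ Real.exp ((2 ^ n : ℝ≥0) : ℝ) + 1 := fun z hz => by
      refine (norm_sub_le _ _).trans ?_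
      rw [norm_one, norm_mul]
      refine add_le_add_left ?_ 1
      exact (mul_le_of_le_one_left (norm_nonneg _) (norm_singularFactor_le_one _ hz)).trans
        (hhN z hz)
    have hn1 : 1 / ((n : ℝ) + 1) ≤ 1 := by
      rw [div_le_one (by positivity)]
      linarith [n.cast_nonneg (α := ℝ)]
    have hε : ∀ z, ‖z‖ ≤ 1 - (δ n : ℝ) → ‖θ z * h z - 1‖ ≤ 2 * (1 / ((n : ℝ) + 1)) := fun z hz =>
      (norm_singularFactor_mul_inv_sub_one_le (measurable_clearAllDigits p)
        (measurable_clearDigits p n) (abs_clearAllDigits_sub_le hpm n (hp0 n)) hz (by linarith)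
        ((hpp n).2.trans hn1)).trans (mul_le_mul_of_nonneg_left (hpp n).2 zero_le_two)
    have key := norm_le_of_mem_modelSpace (differentiableOn_singularFactor _) hhd hhN hfθ
      (by linarith : 0 < 1 - (δ n : ℝ)) (by linarith) hB (hC (δ n) (hδ1 n).le) hM hε hw
    refine key.trans ?_
    have hw1 : 0 ≤ (1 - ‖w‖)⁻¹ := inv_nonneg.2 (by linarith [mem_ball_zero_iff.1 hw])
    have h1 := mul_le_mul_of_nonneg_left (hδω n) hC0
    calc _ ≤ (C * (1 / ((n : ℝ) + 1)) + B * (2 * (1 / ((n : ℝ) + 1)))) * (1 - ‖w‖)⁻¹ := by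
          refine mul_le_mul_of_nonneg_right ?_ hw1
          linarith
      _ = _ := by ring
  have hlim := tendsto_one_div_add_atTop_nhds_zero_nat (𝕜 := ℝ) |>.const_mul
    ((C + 2 * B) * (1 - ‖w‖)⁻¹)
  rw [mul_zero] at hlim
  exact norm_le_zero_iff.1 (ge_of_tendsto' hlim hbound)
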